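/- Let $k$ be an algebraically closed field. For $r \ge 1$ let $K_r$ be the Kronecker quiver with vertices $1,2$ and $r$ arrows $\gamma_1,\dots,\gamma_r\colon 1\to 2$, and let $A_r=\bigoplus_{i=1}^r k\gamma_i$. A finite dimensional representation of $K_r$ is a triple $M=(M_1,M_2,\psi_M\colon A_r\otimes M_1\to M_2)$ with $M_1,M_2$ finite dimensional vector spaces and $\psi_M$ linear; let $\operatorname{rep}(K_r)$ be the category of these. For $g\in \mathrm{GL}(A_r)$ let $g.M=(M_1,M_2,\psi_M\circ(g^{-1}\otimes \mathrm{id}))$, and for an injective linear map $\alpha\colon A_d\to A_r$ let $\alpha^*(M)=(M_1,M_2,\psi_M\circ(\alpha\otimes\mathrm{id}))\in\operatorname{rep}(K_d)$. The shift $\sigma(M)$ is $(\ker\psi_M, M_1)$ with structure map induced by $\gamma_i\otimes(\gamma_j\otimes m)\mapsto\delta_{ij}m$. The inverse shift $\sigma^{-1}(M)$ is $(M_2,\operatorname{coker}\eta_M)$, where $\eta_M\colon M_1\to A_r\otimes M_2$, $\eta_M(m)=\sum_i\gamma_i\otimes\psi_M(\gamma_i\otimes m)$, with the canonical structure map $A_r\otimes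 M_2\to\operatorname{coker}\eta_M$. Then $\sigma^{-1}\circ\sigma^{-1}=\tau^{-1}$ is the inverse Auslander--Reiten translation. Let $1\le d<r$. Let $P_0(d)=(0,k)$, $P_1(d)=(k,A_d)$ with structure map $a\otimes t\mapsto ta$, and $P_{n+2}(d)=\tau^{-1}(P_n(d))$. For $d\geq 2$ these are the indecomposable preprojective representations of $K_d$; for $d=1$, $P_2(1)\cong\sigma^{-1}(P_1(1))$ is the simple injective representation $(k,0)$. Let $a_n(d)=\dim_k P_n(d)_1$. For $X\in\operatorname{rep}(K_d)$ let $\inf(X)\in\operatorname{rep}(K_r)$ be the representation on which $\gamma_1,\dots,\gamma_d$ act as on $X$ and $\gamma_{d+1},\dots,\gamma_r$ act by zero. For a $d$-dimensional subspace $\mathfrak v\subseteq A_r$ put $$P_n^-(\mathfrak v)=g.\sigma^{-1}(\inf P_n(d)),\qquad P_n^+(\mathfrak v)=g.\sigma(\inf P_n(d)),$$ where $g\in\mathrm{GL}(A_r)$ is any element that maps $A_d=\langle\gamma_1,\dots,\gamma_d\rangle$ onto $\mathfrak v$. Write $M|_{\mathfrak v}$ for $\alpha^*(M)$, where $\alpha\colon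 A_d\to A_r$ is any injective linear map with image $\mathfrak v$. **Theorem.** Let $M\in\operatorname{rep}(K_r)$, let $n\ge 0$ (with $n\le 1$ if $d=1$), and let $\mathfrak v\subseteq A_r$ be a subspace of dimension $d$. For any choices of $\alpha$ and of the elements $g$ as above, the following statements are equivalent: 1. The integers $b=-a_{n+2}(d)\dim_k M_1+a_{n+1}(d)\dim_k M_2$ and $c=a_{n+1}(d)\dim_k M_1-a_n(d)\dim_k M_2$ are non-negative and $M|_{\mathfrak v}\cong b\,P_n(d)\oplus c\,P_{n+1}(d)$. 2. $M|_{\mathfrak v}\in\operatorname{add}(P_n(d),P_{n+1}(d))$, i.e. $M|_{\mathfrak v}$ is a direct summand of a finite direct sum of copies of $P_n(d)$ and $P_{n+1}(d)$. 3. $\operatorname{Hom}_{K_r}(P_{n+1}^-(\mathfrak v),M)=0=\operatorname{Hom}_{K_r}(M,P_n^+(\mathfrak v))$. -/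

import Mathlib

universe u v w

namespace Kronecker

/-- The arrow space `A_r` of the Kronecker quiver `K_r` (two vertices `1, 2` and `r` arrows
`1 ⟶ 2`); its standard basis `γ_i = Pi.single i 1` is the set of arrows. -/
abbrev ArrowSpace (k : Type u) (r : ℕ) : Type u := Fin r → k

/-- A finite dimensional representation of `K_r`: two finite dimensional vector spaces and a
structure map `A_r ⊗ M₁ ⟶ M₂`, written as a bilinear map. -/
structure Rep (k : Type u) [Field k] (r : ℕ) where
  /-- the space at the vertex `1` -/
  V₁ : Type v
  /-- the space at the vertex `2` -/
  V₂ : Type v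
  [acg₁ : AddCommGroup V₁]
  [acg₂ : AddCommGroup V₂]
  [mod₁ : Module k V₁]
  [mod₂ : Module k V₂]
  [fin₁ : Module.Finite k V₁]
  [fin₂ : Module.Finite k V₂]
  /-- the structure map -/
  ψ : ArrowSpace k r →ₗ[k] V₁ →ₗ[k] V₂

attribute [instance] Rep.acg₁ Rep.acg₂ Rep.mod₁ Rep.mod₂ Rep.fin₁ Rep.fin₂

namespace Rep

variable {k : Type u} [Field k] {d r : ℕ}

/-- Morphisms of representations. -/
structure Hom (M : Rep.{u, v} k r) (N : Rep.{u, w} k r) where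
  f₁ : M.V₁ →ₗ[k] N.V₁
  f₂ : M.V₂ →ₗ[k] N.V₂
  comm : ∀ (a : ArrowSpace k r) (m : M.V₁), f₂ (M.ψ a m) = N.ψ a (f₁ m)

/-- `Hom(M, N) = 0`. -/
def HomEqZero (M : Rep.{u, v} k r) (N : Rep.{u, w} k r) : Prop :=
  ∀ f : Hom M N, f.f₁ = 0 ∧ f.f₂ = 0

/-- Isomorphisms of representations. -/
structure Iso (M : Rep.{u, v} k r) (N : Rep.{u, w} k r) where
  e₁ : M.V₁ ≃ₗ[k] N.V₁
  e₂ : M.V₂ ≃ₗ[k] N.V₂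
  comm : ∀ (a : ArrowSpace k r) (m : M.V₁), e₂ (M.ψ a m) = N.ψ a (e₁ m)

/-- The direct sum `M ⊕ N`. -/
def sum (M : Rep.{u, v} k r) (N : Rep.{u, w} k r) : Rep.{u, max v w} k r where
  V₁ := M.V₁ × N.V₁
  V₂ := M.V₂ × N.V₂
  ψ := LinearMap.mk₂ k (fun a x => (M.ψ a x.1, N.ψ a x.2))
    (by intros; simp) (by intros; simp) (by intros; simp) (by intros; simp)

/-- The direct sum `b M` of `b` copies of `M`. -/
def copies (b : ℕ) (M : Rep.{u, v} k r) : Rep.{u, v} k r where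
  V₁ := Fin b → M.V₁
  V₂ := Fin b → M.V₂
  ψ := LinearMap.mk₂ k (fun a x j => M.ψ a (x j))
    (by intros; ext; simp) (by intros; ext; simp) (by intros; ext; simp) (by intros; ext; simp)

/-- `M ∈ add(X, Y)`: `M` is a direct summand of a finite direct sum of copies of `X` and `Y`. -/
def MemAdd (M : Rep.{u, v} k r) (X Y : Rep.{u, u} k r) : Prop :=
  ∃ (N : Rep.{u, u} k r) (b c : ℕ),
    Nonempty (Iso (M.sum N) ((X.copies b).sum (Y.copies c)))

/-- The restriction `α^*(M)` of `M` along a linear map `α : A_d ⟶ A_r`. -/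
def restrict (α : ArrowSpace k d →ₗ[k] ArrowSpace k r) (M : Rep.{u, v} k r) :
    Rep.{u, v} k d where
  V₁ := M.V₁
  V₂ := M.V₂
  ψ := M.ψ ∘ₗ α

/-- The twist `g.M` of `M` by `g ∈ GL(A_r)`, with structure map `ψ_M ∘ (g⁻¹ ⊗ id)`. -/
def twist (g : ArrowSpace k r ≃ₗ[k] ArrowSpace k r) (M : Rep.{u, v} k r) : Rep.{u, v} k r where
  V₁ := M.V₁
  V₂ := M.V₂
  ψ := M.ψ ∘ₗ g.symm.toLinearMap

/-- The inflation `inf(X)` of `X` along `d ≤ r`: the arrows `γ_i` with `i ≤ d` act as on `X`,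
the others act as zero. -/
def inflate (h : d ≤ r) (X : Rep.{u, v} k d) : Rep.{u, v} k r where
  V₁ := X.V₁
  V₂ := X.V₂
  ψ := X.ψ ∘ₗ LinearMap.funLeft k k (Fin.castLE h)

/-- The structure map as a linear map on `A_r ⊗ M₁`, where `∑ i, γ_i ⊗ x_i` is written as the
tuple `(x_i)`. -/
def total (M : Rep.{u, v} k r) : (Fin r → M.V₁) →ₗ[k] M.V₂ :=
  ∑ i, M.ψ (Pi.single i 1) ∘ₗ LinearMap.proj i

/-- The map `η_M : M₁ ⟶ A_r ⊗ M₂, m ↦ ∑ i, γ_i ⊗ ψ_M (γ_i ⊗ m)`, in the same notation. -/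
def eta (M : Rep.{u, v} k r) : M.V₁ →ₗ[k] (Fin r → M.V₂) :=
  LinearMap.pi fun i => M.ψ (Pi.single i 1)

/-- The shift `σ(M) = (ker ψ_M, M₁)`, with structure map induced by
`γ_i ⊗ (γ_j ⊗ m) ↦ δ_ij m`. -/
def shift (M : Rep.{u, v} k r) : Rep.{u, v} k r where
  V₁ := LinearMap.ker M.total
  V₂ := M.V₁
  ψ := LinearMap.mk₂ k (fun a x => ∑ i, a i • x.1 i)
    (by intros; simp [add_smul, Finset.sum_add_distrib])
    (by intros; simp [mul_smul, Finset.smul_sum])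
    (by intros; simp [Finset.sum_add_distrib])
    (by
      intro c a x
      rw [Finset.smul_sum]
      exact Finset.sum_congr rfl fun i _ => smul_comm (a i) c (x.1 i))

/-- The inverse shift `σ⁻¹(M) = (M₂, coker η_M)`, with structure map
`a ⊗ m ↦ a ⊗ m + im η_M`. -/
def shiftInv (M : Rep.{u, v} k r) : Rep.{u, v} k r where
  V₁ := M.V₂
  V₂ := (Fin r → M.V₂) ⧸ LinearMap.range M.eta
  ψ := LinearMap.mk₂ k (fun a m => (LinearMap.range M.eta).mkQ (fun i => a i • m))
    (by intros; rw [← map_add]; congr 1; ext; simp [add_smul])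
    (by intros; rw [← map_smul]; congr 1; ext; simp [mul_smul])
    (by intros; rw [← map_add]; congr 1; ext; simp)
    (by
      intro c a m
      rw [← map_smul]
      congr 1
      ext i
      exact smul_comm (a i) c m)

/-- The inverse Auslander-Reiten translation `τ⁻¹ = σ⁻¹ ∘ σ⁻¹` (the inverse Coxeter functor;
explicitly, the cokernel of the inverse Nakayama functor on the standard injective
resolution). -/
def tauInv (M : Rep.{u, v} k r) : Rep.{u, v} k r := M.shiftInv.shiftInv

end Rep

/-- The simple projective representation `P_0(d) = S(2) = (0, k)`. -/
def P0 (k : Type u) [Field k] (d : ℕ) : Rep.{u, u} k d where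
  V₁ := PUnit
  V₂ := k
  ψ := 0

/-- The projective cover `P_1(d) = (k, A_d)` of `S(1)`, with structure map `a ⊗ t ↦ t a`. -/
def P1 (k : Type u) [Field k] (d : ℕ) : Rep.{u, u} k d where
  V₁ := k
  V₂ := ArrowSpace k d
  ψ := (LinearMap.lsmul k (ArrowSpace k d)).flip

/-- The preprojective representations `P_n(d)`: `P_{2l} = τ^{-l} P_0` and
`P_{2l+1} = τ^{-l} P_1`. For `d = 1` only `n ≤ 2` is relevant: `P_0, P_1` are the projective
indecomposables and `P_2(1) = σ⁻¹ P_1(1)` is the simple injective `(k, 0)`. -/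
def P (k : Type u) [Field k] (d : ℕ) : ℕ → Rep.{u, u} k d
  | 0 => P0 k d
  | 1 => P1 k d
  | n + 2 => (P k d n).tauInv

/-- The integers `a_n(d) = dim P_n(d)₁`; the dimension vector of `P_n(d)` is
`(a_n(d), a_{n+1}(d))`. -/
noncomputable def a (k : Type u) [Field k] (d n : ℕ) : ℕ := Module.finrank k (P k d n).V₁

/-- The canonical embedding `ι : A_d ⟶ A_r`, `γ_i ↦ γ_i`. -/
noncomputable def incl (k : Type u) [Field k] {d r : ℕ} (h : d ≤ r) :
    ArrowSpace k d →ₗ[k] ArrowSpace k r :=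
  Function.ExtendByZero.linearMap k (Fin.castLE h)

/-- For `g ∈ GL(A_r)` with `g ∘ ι = α`, the representation `X⁻(α) = g.σ⁻¹(inf X)`. -/
def testMinus {k : Type u} [Field k] {d r : ℕ} (h : d ≤ r)
    (g : ArrowSpace k r ≃ₗ[k] ArrowSpace k r) (X : Rep.{u, v} k d) : Rep.{u, v} k r :=
  (X.inflate h).shiftInv.twist g

/-- For `g ∈ GL(A_r)` with `g ∘ ι = α`, the representation `X⁺(α) = g.σ(inf X)`. -/
def testPlus {k : Type u} [Field k] {d r : ℕ} (h : d ≤ r)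
    (g : ArrowSpace k r ≃ₗ[k] ArrowSpace k r) (X : Rep.{u, v} k d) : Rep.{u, v} k r :=
  (X.inflate h).shift.twist g

end Kronecker

-- Morphisms `σ⁻¹ X ⟶ N` and `X ⟶ σ N` are both encoded by a linear map `f : X₂ ⟶ N₁` with `∑ i,
-- N(γ_i) f X(γ_i) = 0`; `ShiftOrthogonal X N` says that only `f = 0` occurs. If one argument is
-- inflated from `K_d`, the arrows beyond `d` drop out of the sum, so only the restriction of the
-- other argument to `A_d` matters. Different choices of `α` and `g` change this restriction by an
-- element of `GL(A_d)`, which is harmless because every `P_n(d)` is isomorphic to its twists. Hence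
-- statement 3 is a statement about `N = M|_𝔳` over `K_d` alone: `ShiftOrthogonal P_{n+1} N` and
-- `ShiftOrthogonal N P_n`.
--
-- Sums of copies of `P_n` and `P_{n+1}`, and their summands, satisfy both conditions: the
-- adjunction and `P_{n+1} = σ⁻¹ P_n` lower the indices until `P_0` appears, whose first space is
-- zero.
--
-- The converse (`nonempty_iso_of_shiftOrthogonal`) is an induction on `n`. For `n = 0` the first
-- condition makes `ψ_N` injective, and such an `N` is a sum of copies of `P_0` and `P_1`. In the
-- step, the second condition reads `Hom(N, P_n) = 0` and forces `ψ_N` to be surjective, so `N ≅ σ⁻¹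
-- σ N`; both conditions pass to `σ N` with index lowered by one, and `σ⁻¹` carries its
-- decomposition back.
--
-- The multiplicities come from dimension vectors by Cramer's rule, since `a_{n+1}² - a_n a_{n+2} =
-- 1`.

universe v' w'

namespace Kronecker

namespace Rep

variable {k : Type u} [Field k] {d r : ℕ}

/-! ### Structure maps in coordinates, and isomorphisms -/

section Basic

variable (M : Rep.{u, v} k r)

theorem total_apply (x : Fin r → M.V₁) :
    M.total x = ∑ i, M.ψ (Pi.single i 1) (x i) := by
  simp [total]

theorem eta_apply (m : M.V₁) (i : Fin r) : M.eta m i = M.ψ (Pi.single i 1) m := rfl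

theorem psi_eq_sum (a : ArrowSpace k r) (m : M.V₁) :
    M.ψ a m = ∑ i, a i • M.ψ (Pi.single i 1) m := by
  conv_lhs => rw [pi_eq_sum_univ' a]
  simp only [map_sum, map_smul, LinearMap.sum_apply, LinearMap.smul_apply]

theorem total_smul (a : ArrowSpace k r) (m : M.V₁) :
    M.total (fun i => a i • m) = M.ψ a m := by
  rw [total_apply, psi_eq_sum]
  simp

end Basic

namespace Iso

/-- The identity isomorphism. -/
def refl (M : Rep.{u, v} k r) : Iso M M := ⟨.refl k _, .refl k _, fun _ _ => rfl⟩

/-- The inverse of an isomorphism. -/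
def symm {M : Rep.{u, v} k r} {N : Rep.{u, w} k r} (e : Iso M N) : Iso N M :=
  ⟨e.e₁.symm, e.e₂.symm, fun a m => by rw [LinearEquiv.symm_apply_eq, e.comm]; simp⟩

/-- The composition of isomorphisms. -/
def trans {L : Rep.{u, v'} k r} {M : Rep.{u, v} k r} {N : Rep.{u, w} k r} (e : Iso L M)
    (f : Iso M N) : Iso L N :=
  ⟨e.e₁.trans f.e₁, e.e₂.trans f.e₂, fun a m => by simp [e.comm, f.comm]⟩

end Iso

/-! ### The shift adjunction and shift pairs -/

/-- There is no nonzero linear map `f : X₂ ⟶ N₁` with `∑ i, ψ_N (γ_i ⊗ f (ψ_X (γ_i ⊗ x))) = 0`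
for all `x`. This is the common value of `Hom(σ⁻¹ X, N) = 0` and `Hom(X, σ N) = 0`. -/
def ShiftOrthogonal (X : Rep.{u, v} k r) (N : Rep.{u, w} k r) : Prop :=
  ∀ f : X.V₂ →ₗ[k] N.V₁,
    (∀ x, ∑ i, N.ψ (Pi.single i 1) (f (X.ψ (Pi.single i 1) x)) = 0) → f = 0

theorem ShiftOrthogonal.congr {M : Rep.{u, v} k r} {M' : Rep.{u, v'} k r} {N : Rep.{u, w} k r}
    {N' : Rep.{u, w'} k r} (e : Iso M M') (f : Iso N N') (h : ShiftOrthogonal M N) :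
    ShiftOrthogonal M' N' := by
  intro g hg
  have hf (a : ArrowSpace k r) (m : N'.V₁) : f.e₂.symm (N'.ψ a m) = N.ψ a (f.e₁.symm m) :=
    f.symm.comm a m
  have := h (f.e₁.symm.toLinearMap ∘ₗ g ∘ₗ e.e₂.toLinearMap) (fun x => by
    have := congrArg f.e₂.symm (hg (e.e₁ x))
    rw [map_sum, map_zero] at this
    simpa [e.comm, ← hf] using this)
  ext x
  simpa using LinearMap.congr_fun this (e.e₂.symm x)

theorem shiftOrthogonal_congr {M : Rep.{u, v} k r} {M' : Rep.{u, v'} k r} {N : Rep.{u, w} k r}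
    {N' : Rep.{u, w'} k r} (e : Iso M M') (f : Iso N N') :
    ShiftOrthogonal M N ↔ ShiftOrthogonal M' N' :=
  ⟨.congr e f, .congr e.symm f.symm⟩

/-- An identification `X₂ ≅ Z₁` for which `X₁ ⟶ A_r ⊗ X₂ ≅ A_r ⊗ Z₁ ⟶ Z₂` is exact. If moreover
`ψ_Z` is surjective, then `Z = σ⁻¹ X`; if moreover `η_X` is injective, then `X = σ Z`. -/
structure ShiftPair (X : Rep.{u, v} k r) (Z : Rep.{u, w} k r) where
  /-- the identification `X₂ ≅ Z₁` -/
  e : X.V₂ ≃ₗ[k] Z.V₁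
  exact : ∀ y : Fin r → X.V₂, Z.total (fun i => e (y i)) = 0 ↔ ∃ x, X.eta x = y

theorem shiftInv_total (M : Rep.{u, v} k r) (x : Fin r → M.V₂) :
    M.shiftInv.total x = (LinearMap.range M.eta).mkQ x := by
  have key : ∑ i, (LinearMap.range M.eta).mkQ
      (fun j => (Pi.single i 1 : ArrowSpace k r) j • x i) = (LinearMap.range M.eta).mkQ x := by
    rw [← map_sum]
    congr 1
    ext j
    simp [Finset.sum_apply, Pi.single_apply]
  exact (total_apply _ _).trans key

theorem shiftInv_total_surjective (M : Rep.{u, v} k r) :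
    Function.Surjective M.shiftInv.total := by
  intro y
  obtain ⟨x, hx⟩ := Submodule.mkQ_surjective (LinearMap.range M.eta) y
  exact ⟨x, (M.shiftInv_total x).trans hx⟩

/-- The pair `(X, σ⁻¹ X)`. -/
def shiftPairShiftInv (X : Rep.{u, v} k r) : ShiftPair X X.shiftInv where
  e := .refl k _
  exact y := (Eq.congr_left (X.shiftInv_total y)).trans
    ((Submodule.Quotient.mk_eq_zero _).trans LinearMap.mem_range)

theorem shift_eta (N : Rep.{u, v} k r) (x : LinearMap.ker N.total) : N.shift.eta x = x.1 := by
  have key (i : Fin r) : ∑ j, (Pi.single i 1 : ArrowSpace k r) j • x.1 j = x.1 i := by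
    simp [Pi.single_apply]
  exact funext key

theorem shift_eta_injective (N : Rep.{u, v} k r) : Function.Injective N.shift.eta :=
  fun x y h => Subtype.ext ((N.shift_eta x).symm.trans (h.trans (N.shift_eta y)))

/-- The pair `(σ N, N)`. -/
def shiftPairShift (N : Rep.{u, v} k r) : ShiftPair N.shift N where
  e := .refl k _
  exact y := ⟨fun hy => ⟨⟨y, hy⟩, N.shift_eta _⟩,
    fun ⟨x, hx⟩ => (congrArg N.total (hx.symm.trans (N.shift_eta x))).trans x.2⟩

namespace ShiftPair

section Hom

variable {X : Rep.{u, v} k r} {Z : Rep.{u, w} k r}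

/-- `Hom(σ⁻¹ X, N) = 0` in terms of `X`. -/
theorem homEqZero_left_iff (p : ShiftPair X Z) (hs : Function.Surjective Z.total)
    (N : Rep.{u, w'} k r) :
    HomEqZero Z N ↔ ShiftOrthogonal X N := by
  constructor
  · intro h f hf
    let E : (Fin r → X.V₂) ≃ₗ[k] (Fin r → Z.V₁) := .piCongrRight fun _ => p.e
    let F : (Fin r → Z.V₁) →ₗ[k] N.V₂ := N.total ∘ₗ (f ∘ₗ p.e.symm.toLinearMap).compLeft (Fin r)
    -- By exactness a kernel element is an image under `η_X`, and on such elements the vanishing of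
    -- `F` is the hypothesis on `f`. So `F` descends to the second component of a morphism.
    have hF : LinearMap.ker Z.total ≤ LinearMap.ker F := by
      intro y hy
      obtain ⟨y, rfl⟩ := E.surjective y
      obtain ⟨x, rfl⟩ := (p.exact y).1 hy
      have := hf x
      rw [LinearMap.mem_ker]
      simpa [F, E, total_apply, eta_apply, LinearMap.compLeft] using this
    let G : Z.V₂ →ₗ[k] N.V₂ :=
      (LinearMap.ker Z.total).liftQ F hF ∘ₗ (Z.total.quotKerEquivOfSurjective hs).symm.toLinearMap
    have hG (y : Fin r → Z.V₁) : G (Z.total y) = F y := by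
      have : (Z.total.quotKerEquivOfSurjective hs).symm (Z.total y) =
          (LinearMap.ker Z.total).mkQ y := by
        rw [LinearEquiv.symm_apply_eq]
        rfl
      simp [G, this]
    have h₁ := (h ⟨f ∘ₗ p.e.symm.toLinearMap, G, fun a m => by
      rw [← total_smul, hG, ← total_smul]
      simp only [F, LinearMap.comp_apply]
      congr 1
      ext i
      simp [LinearMap.compLeft]⟩).1
    ext x
    simpa using LinearMap.congr_fun h₁ (p.e x)
  · intro h g
    have h₁ : g.f₁ = 0 := by
      have := h (g.f₁ ∘ₗ p.e.toLinearMap) fun x => by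
        simp only [LinearMap.comp_apply, LinearEquiv.coe_coe, ← g.comm]
        rw [← map_sum, ← Z.total_apply fun i => p.e (X.ψ (Pi.single i 1) x),
          (p.exact fun i => X.ψ (Pi.single i 1) x).2 ⟨x, rfl⟩, map_zero]
      ext y
      simpa using LinearMap.congr_fun this (p.e.symm y)
    refine ⟨h₁, ?_⟩
    ext y
    obtain ⟨x, rfl⟩ := hs y
    simp [total_apply, g.comm, h₁]

/-- `Hom(W, σ Z) = 0` in terms of `Z`. -/
theorem homEqZero_right_iff (p : ShiftPair X Z) (hi : Function.Injective X.eta) (W : Rep.{u, w'} k r) :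
    HomEqZero W X ↔ ShiftOrthogonal W Z := by
  have hsum (f : W.V₂ →ₗ[k] X.V₂) (x : W.V₁) :
      ∑ i, Z.ψ (Pi.single i 1) (p.e (f (W.ψ (Pi.single i 1) x))) = 0 ↔
        ∃ m, X.eta m = fun i => f (W.ψ (Pi.single i 1) x) := by
    rw [← Z.total_apply fun i => p.e (f (W.ψ (Pi.single i 1) x)),
      p.exact fun i => f (W.ψ (Pi.single i 1) x)]
  constructor
  · intro h f' hf'
    obtain ⟨f, rfl⟩ : ∃ f : W.V₂ →ₗ[k] X.V₂, f' = p.e.toLinearMap ∘ₗ f :=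
      ⟨p.e.symm.toLinearMap ∘ₗ f', by ext; simp⟩
    -- The condition on `f` puts `(f (W(γ_i) x))_i` into the image of `η_X`; injectivity of `η_X`
    -- then yields the first component of a morphism.
    let F : W.V₁ →ₗ[k] LinearMap.range X.eta :=
      LinearMap.codRestrict _ (LinearMap.pi fun i => f ∘ₗ W.ψ (Pi.single i 1))
        fun x => (hsum f x).1 (hf' x)
    let E := LinearEquiv.ofInjective X.eta hi
    have hE (x : W.V₁) : X.eta (E.symm (F x)) = fun i => f (W.ψ (Pi.single i 1) x) := by
      have : (E (E.symm (F x))).1 = (F x).1 := by rw [E.apply_symm_apply]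
      exact this
    have h₂ : f = 0 := (h ⟨E.symm.toLinearMap ∘ₗ F, f, fun a m => by
      rw [psi_eq_sum, psi_eq_sum, map_sum]
      refine Finset.sum_congr rfl fun i _ => ?_
      rw [map_smul]
      congr 1
      exact (congrFun (hE m) i).symm⟩).2
    rw [h₂, LinearMap.comp_zero]
  · intro h g
    have h₂ : g.f₂ = 0 := by
      have := h (p.e.toLinearMap ∘ₗ g.f₂) fun x => (hsum g.f₂ x).2
        ⟨g.f₁ x, funext fun i => (g.comm _ _).symm⟩
      ext x
      simpa using LinearMap.congr_fun this x
    refine ⟨?_, h₂⟩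
    ext x
    refine hi (funext fun i => ?_)
    rw [eta_apply, ← g.comm, h₂]
    simp

/-- Dimension count in the exact sequence `0 ⟶ X₁ ⟶ A_r ⊗ X₂ ⟶ Z₂ ⟶ 0`; it gives the recursion for
`a_n`. -/
theorem finrank_add_finrank (p : ShiftPair X Z) (hi : Function.Injective X.eta)
    (hs : Function.Surjective Z.total) :
    Module.finrank k Z.V₂ + Module.finrank k X.V₁ = r * Module.finrank k X.V₂ := by
  let F : X.V₁ →ₗ[k] (Fin r → Z.V₁) := p.e.toLinearMap.compLeft (Fin r) ∘ₗ X.eta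
  have hF : Function.Injective F := fun x y h => hi (funext fun i =>
    p.e.injective (congrFun h i))
  have hr : LinearMap.range F = LinearMap.ker Z.total := by
    ext y
    constructor
    · rintro ⟨x, rfl⟩
      exact (p.exact _).2 ⟨x, rfl⟩
    · intro hy
      obtain ⟨x, hx⟩ := (p.exact fun i => p.e.symm (y i)).1 (by simpa using hy)
      refine ⟨x, funext fun i => ?_⟩
      have : p.e (X.eta x i) = y i := by rw [hx]; simp
      exact this
  have h := LinearMap.finrank_range_add_finrank_ker Z.total
  rw [LinearMap.range_eq_top.2 hs, finrank_top, ← hr, LinearMap.finrank_range_of_inj hF,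
    Module.finrank_pi_fintype] at h
  simpa [← p.e.finrank_eq] using h

end Hom

theorem exists_linearEquiv_of_surjective {A A' B B' : Type*} [AddCommGroup A] [AddCommGroup A']
    [AddCommGroup B] [AddCommGroup B'] [Module k A] [Module k A'] [Module k B] [Module k B']
    (f : A →ₗ[k] B) (f' : A' →ₗ[k] B') (hf : Function.Surjective f) (hf' : Function.Surjective f')
    (E : A ≃ₗ[k] A') (h : ∀ a, f a = 0 ↔ f' (E a) = 0) :
    ∃ e : B ≃ₗ[k] B', ∀ a, e (f a) = f' (E a) := by
  have hk : LinearMap.ker f = LinearMap.ker (f' ∘ₗ E.toLinearMap) := by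
    ext a
    exact h a
  refine ⟨((f.quotKerEquivOfSurjective hf).symm.trans (Submodule.quotEquivOfEq _ _ hk)).trans
    ((f' ∘ₗ E.toLinearMap).quotKerEquivOfSurjective (hf'.comp E.surjective)), fun a => ?_⟩
  have : (f.quotKerEquivOfSurjective hf).symm (f a) = (LinearMap.ker f).mkQ a := by
    rw [LinearEquiv.symm_apply_eq]
    rfl
  rw [LinearEquiv.trans_apply, LinearEquiv.trans_apply, this]
  rfl

/-- The inverse shift is determined up to isomorphism. -/
theorem nonempty_iso {X : Rep.{u, v} k r} {X' : Rep.{u, v'} k r} {Z : Rep.{u, w} k r}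
    {Z' : Rep.{u, w'} k r} (p : ShiftPair X Z) (p' : ShiftPair X' Z')
    (hs : Function.Surjective Z.total) (hs' : Function.Surjective Z'.total) (f : Iso X X') :
    Nonempty (Iso Z Z') := by
  let c : Z.V₁ ≃ₗ[k] Z'.V₁ := (p.e.symm.trans f.e₂).trans p'.e
  obtain ⟨e, he⟩ := exists_linearEquiv_of_surjective Z.total Z'.total hs hs'
    (.piCongrRight fun _ => c) fun y => by
      have h₁ := p.exact fun i => p.e.symm (y i)
      have h₂ := p'.exact fun i => f.e₂ (p.e.symm (y i))
      simp only [LinearEquiv.apply_symm_apply] at h₁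
      refine h₁.trans (Iff.trans ⟨?_, ?_⟩ h₂.symm)
      · rintro ⟨x, hx⟩
        refine ⟨f.e₁ x, funext fun i => ?_⟩
        rw [← congrFun hx i]
        exact (f.comm _ _).symm
      · rintro ⟨x, hx⟩
        refine ⟨f.e₁.symm x, funext fun i => f.e₂.injective ?_⟩
        rw [eta_apply, f.comm, f.e₁.apply_symm_apply]
        exact congrFun hx i
  refine ⟨⟨c, e, fun a m => ?_⟩⟩
  rw [← total_smul, he, ← total_smul]
  congr 1
  ext i
  simp

theorem total_sum (X : Rep.{u, v} k r) (Y : Rep.{u, w} k r) (y : Fin r → X.V₁ × Y.V₁) :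
    (X.sum Y).total y = (X.total fun i => (y i).1, Y.total fun i => (y i).2) := by
  refine (total_apply _ _).trans ?_
  rw [total_apply, total_apply]
  exact Prod.ext (Prod.fst_sum ..) (Prod.snd_sum ..)

theorem total_copies (X : Rep.{u, v} k r) (b : ℕ) (y : Fin r → Fin b → X.V₁) :
    (X.copies b).total y = fun j => X.total fun i => y i j := by
  refine (total_apply _ _).trans (funext fun j => ?_)
  rw [total_apply]
  exact Finset.sum_apply ..

theorem total_sum_surjective {X : Rep.{u, v} k r} {Y : Rep.{u, w} k r}
    (hX : Function.Surjective X.total) (hY : Function.Surjective Y.total) :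
    Function.Surjective (X.sum Y).total := by
  rintro ⟨y, z⟩
  obtain ⟨y, rfl⟩ := hX y
  obtain ⟨z, rfl⟩ := hY z
  exact ⟨fun i => (y i, z i), total_sum ..⟩

theorem total_copies_surjective {X : Rep.{u, v} k r} (hX : Function.Surjective X.total) (b : ℕ) :
    Function.Surjective (X.copies b).total := by
  intro z
  choose y hy using fun j => hX (z j)
  exact ⟨fun i j => y j i, (total_copies ..).trans (funext hy)⟩

/-- The direct sum of two pairs. -/
def sum {X : Rep.{u, v} k r} {X' : Rep.{u, v'} k r} {Z : Rep.{u, w} k r}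
    {Z' : Rep.{u, w'} k r} (p : ShiftPair X Z) (p' : ShiftPair X' Z') :
    ShiftPair (X.sum X') (Z.sum Z') where
  e := p.e.prodCongr p'.e
  exact y := by
    refine (Eq.congr_left (total_sum Z Z' fun i => (p.e (y i).1, p'.e (y i).2))).trans ?_
    refine Prod.mk_eq_zero.trans ((and_congr (p.exact _) (p'.exact _)).trans ⟨?_, ?_⟩)
    · rintro ⟨⟨x, hx⟩, ⟨z, hz⟩⟩
      exact ⟨(x, z), funext fun i => Prod.ext (congrFun hx i) (congrFun hz i)⟩
    · rintro ⟨x, rfl⟩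
      exact ⟨⟨x.1, rfl⟩, ⟨x.2, rfl⟩⟩

/-- The direct sum of copies of a pair. -/
def copies {X : Rep.{u, v} k r} {Z : Rep.{u, w} k r} (p : ShiftPair X Z) (b : ℕ) :
    ShiftPair (X.copies b) (Z.copies b) where
  e := .piCongrRight fun _ => p.e
  exact y := by
    refine (Eq.congr_left (total_copies Z b fun i j => p.e (y i j))).trans ?_
    refine funext_iff.trans ((forall_congr' fun j => p.exact fun i => y i j).trans ⟨?_, ?_⟩)
    · intro h
      choose x hx using h
      exact ⟨x, funext fun i => funext fun j => congrFun (hx j) i⟩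
    · rintro ⟨x, rfl⟩ j
      exact ⟨x j, rfl⟩

end ShiftPair

theorem homEqZero_shiftInv_iff (X : Rep.{u, v} k r) (N : Rep.{u, w} k r) :
    HomEqZero X.shiftInv N ↔ ShiftOrthogonal X N :=
  X.shiftPairShiftInv.homEqZero_left_iff X.shiftInv_total_surjective N

theorem homEqZero_shift_iff (X : Rep.{u, v} k r) (N : Rep.{u, w} k r) :
    HomEqZero X N.shift ↔ ShiftOrthogonal X N :=
  N.shiftPairShift.homEqZero_right_iff N.shift_eta_injective X

end Rep

variable {k : Type u} [Field k] {d r : ℕ}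

/-! ### Twisting by automorphisms of the arrow space -/

/-- The transpose of an automorphism of the arrow space. -/
theorem exists_transpose (e : ArrowSpace k r ≃ₗ[k] ArrowSpace k r) :
    ∃ t : ArrowSpace k r ≃ₗ[k] ArrowSpace k r,
      ∀ i j, t (Pi.single j 1) i = e (Pi.single i 1) j := by
  let T (L : ArrowSpace k r →ₗ[k] ArrowSpace k r) : ArrowSpace k r →ₗ[k] ArrowSpace k r :=
    (LinearMap.toMatrix' L).transpose.toLin'
  have hT (L L' : ArrowSpace k r →ₗ[k] ArrowSpace k r) (h : L' ∘ₗ L = .id) :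
      T L ∘ₗ T L' = .id := by
    rw [← Matrix.toLin'_mul, ← Matrix.transpose_mul, ← LinearMap.toMatrix'_comp, h,
      LinearMap.toMatrix'_id, Matrix.transpose_one, Matrix.toLin'_one]
  refine ⟨.ofLinearMap (T e) (T e.symm) (hT _ _ ?_) (hT _ _ ?_), fun i j => ?_⟩
  · ext; simp
  · ext; simp
  · simp [T, LinearMap.toMatrix'_apply]

/-- The map `L ⊗ id` on `A_r ⊗ V`. -/
def tensorMap {V : Type*} [AddCommGroup V] [Module k V]
    (L : ArrowSpace k r →ₗ[k] ArrowSpace k r) (y : Fin r → V) : Fin r → V :=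
  fun j => ∑ i, L (Pi.single i 1) j • y i

theorem tensorMap_tensorMap {V : Type*} [AddCommGroup V] [Module k V]
    {L L' : ArrowSpace k r →ₗ[k] ArrowSpace k r} (h : ∀ a, L (L' a) = a) (y : Fin r → V) :
    tensorMap L (tensorMap L' y) = y := by
  have key (j l : Fin r) : ∑ i, L (Pi.single i 1) j * L' (Pi.single l 1) i =
      (Pi.single l 1 : ArrowSpace k r) j := by
    conv_rhs => rw [← h (Pi.single l 1), pi_eq_sum_univ' (L' (Pi.single l 1))]
    simp [Finset.sum_apply, mul_comm]
  ext j
  simp only [tensorMap, Finset.smul_sum, smul_smul]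
  rw [Finset.sum_comm]
  simp only [← Finset.sum_smul, key]
  simp [Pi.single_apply]

namespace Rep

/-- Expanding `e γ_i` in the basis and exchanging the two sums moves `e` to the other argument as
its transpose. -/
theorem shiftOrthogonal_restrict_iff (X : Rep.{u, v} k r) (N : Rep.{u, w} k r)
    {e t : ArrowSpace k r ≃ₗ[k] ArrowSpace k r}
    (h : ∀ i j, t (Pi.single j 1) i = e (Pi.single i 1) j) :
    ShiftOrthogonal X (N.restrict e.toLinearMap) ↔
      ShiftOrthogonal (X.restrict t.toLinearMap) N := by
  refine forall_congr' fun f => imp_congr_left (forall_congr' fun x => Eq.congr_left ?_)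
  have key (f : X.V₂ →ₗ[k] N.V₁) (x : X.V₁) :
      ∑ i, N.ψ (e (Pi.single i 1)) (f (X.ψ (Pi.single i 1) x)) =
        ∑ i, N.ψ (Pi.single i 1) (f (X.ψ (t (Pi.single i 1)) x)) := by
    have h₁ (i : Fin r) (m : N.V₁) := N.psi_eq_sum (e (Pi.single i 1)) m
    have h₂ (i : Fin r) (m : X.V₁) := X.psi_eq_sum (t (Pi.single i 1)) m
    simp only [h₁, h₂, map_sum, map_smul, h]
    exact Finset.sum_comm
  exact key f x

/-- `X` is isomorphic to all its twists by automorphisms of the arrow space. -/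
def TwistInvariant (X : Rep.{u, v} k r) : Prop :=
  ∀ e : ArrowSpace k r ≃ₗ[k] ArrowSpace k r, Nonempty (Iso (X.restrict e.toLinearMap) X)

theorem TwistInvariant.shiftOrthogonal_left_iff {X : Rep.{u, v} k r} (hX : X.TwistInvariant)
    (N : Rep.{u, w} k r) (e : ArrowSpace k r ≃ₗ[k] ArrowSpace k r) :
    ShiftOrthogonal X (N.restrict e.toLinearMap) ↔ ShiftOrthogonal X N := by
  obtain ⟨t, ht⟩ := exists_transpose e
  obtain ⟨f⟩ := hX t
  exact (shiftOrthogonal_restrict_iff X N ht).trans (shiftOrthogonal_congr f (.refl N))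

theorem TwistInvariant.shiftOrthogonal_right_iff {X : Rep.{u, v} k r} (hX : X.TwistInvariant)
    (N : Rep.{u, w} k r) (e : ArrowSpace k r ≃ₗ[k] ArrowSpace k r) :
    ShiftOrthogonal (N.restrict e.toLinearMap) X ↔ ShiftOrthogonal N X := by
  obtain ⟨t, ht⟩ := exists_transpose e
  obtain ⟨f⟩ := hX t
  exact (shiftOrthogonal_restrict_iff N X fun i j => (ht j i).symm).symm.trans
    (shiftOrthogonal_congr (.refl N) f)

theorem total_restrict (Z : Rep.{u, v} k r) (L : ArrowSpace k r →ₗ[k] ArrowSpace k r)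
    (y : Fin r → Z.V₁) : (Z.restrict L).total y = Z.total (tensorMap L y) := by
  have key : ∑ i, Z.ψ (L (Pi.single i 1)) (y i) = Z.total (tensorMap L y) := by
    have h (i : Fin r) := Z.psi_eq_sum (L (Pi.single i 1)) (y i)
    simp only [total_apply, tensorMap, h, map_sum, map_smul]
    exact Finset.sum_comm
  exact (total_apply _ _).trans key

/-- With `t` the transpose of `e⁻¹`, twisting `X` by `t` and `Z` by `e` keeps the sequence exact. So
the twist of `Z` is the inverse shift of a twist of `X`, hence isomorphic to `Z`. -/
theorem TwistInvariant.of_shiftPair {X : Rep.{u, v} k r} {Z : Rep.{u, w} k r}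
    (hX : X.TwistInvariant) (p : ShiftPair X Z) (hs : Function.Surjective Z.total) :
    Z.TwistInvariant := by
  intro e
  obtain ⟨t, ht⟩ := exists_transpose e.symm
  obtain ⟨f⟩ := hX t
  have hη (x : X.V₁) : (X.restrict t.toLinearMap).eta x =
      tensorMap e.symm.toLinearMap (X.eta x) := by
    have key (i : Fin r) : X.ψ (t (Pi.single i 1)) x =
        tensorMap e.symm.toLinearMap (X.eta x) i := by
      rw [psi_eq_sum]
      exact Finset.sum_congr rfl fun j _ => by rw [ht]; rfl
    exact funext key
  have hep (y : Fin r → X.V₂) : tensorMap e.toLinearMap (fun i => p.e (y i)) =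
      fun i => p.e (tensorMap e.toLinearMap y i) := by
    ext j
    simp [tensorMap]
  have hinv (y : Fin r → Z.V₁) :
      tensorMap e.toLinearMap (tensorMap e.symm.toLinearMap y) = y :=
    tensorMap_tensorMap e.apply_symm_apply y
  have hiff (y : Fin r → X.V₂) : Z.total (tensorMap e.toLinearMap fun i => p.e (y i)) = 0 ↔
      ∃ x, tensorMap e.symm.toLinearMap (X.eta x) = y := by
    rw [hep, p.exact]
    refine exists_congr fun x => ⟨fun h => ?_, ?_⟩
    · rw [h]
      exact tensorMap_tensorMap e.symm_apply_apply y
    · rintro rfl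
      exact (tensorMap_tensorMap e.apply_symm_apply _).symm
  refine ShiftPair.nonempty_iso (X := X.restrict t.toLinearMap) ⟨p.e, fun y => ?_⟩ p ?_ hs f
  · exact (Eq.congr_left (Z.total_restrict _ _)).trans
      ((hiff y).trans (exists_congr fun x => Eq.congr_left (hη x).symm))
  · intro z
    obtain ⟨y, rfl⟩ := hs z
    exact ⟨tensorMap e.symm.toLinearMap y,
      (Z.total_restrict _ _).trans (congrArg Z.total (hinv y))⟩

/-! ### Expansion, a shift-stable reason for `η` to be injective -/

/-- The subspace of `M₂` generated by `U ⊆ M₁`. -/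
noncomputable def generated (M : Rep.{u, v} k r) (U : Submodule k M.V₁) : Submodule k M.V₂ :=
  LinearMap.range (M.total ∘ₗ U.subtype.compLeft (Fin r))

theorem generated_le {M : Rep.{u, v} k r} {U : Submodule k M.V₁} {V : Submodule k M.V₂}
    (h : ∀ i, ∀ m ∈ U, M.ψ (Pi.single i 1) m ∈ V) : M.generated U ≤ V := by
  rintro _ ⟨y, rfl⟩
  rw [LinearMap.comp_apply, total_apply]
  exact Submodule.sum_mem _ fun i _ => h i _ (y i).2

/-- Every nonzero subspace of `M₁` generates a subspace of `M₂` of larger dimension. -/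
def Expanding (M : Rep.{u, v} k r) : Prop :=
  ∀ U : Submodule k M.V₁, U ≠ ⊥ → Module.finrank k U < Module.finrank k (M.generated U)

theorem Expanding.eta_injective {M : Rep.{u, v} k r} (hM : M.Expanding) :
    Function.Injective M.eta := by
  rw [← LinearMap.ker_eq_bot]
  by_contra hU
  have h := hM _ hU
  have h0 : M.generated (LinearMap.ker M.eta) ≤ ⊥ :=
    generated_le fun i m hm => congrFun (LinearMap.mem_ker.1 hm) i
  rw [le_bot_iff.1 h0, finrank_bot] at h
  omega

theorem Expanding.nontrivial {M : Rep.{u, v} k r} (hM : M.Expanding) [Nontrivial M.V₁] :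
    Nontrivial M.V₂ := by
  have h := (hM ⊤ top_ne_bot).trans_le (Submodule.finrank_le _)
  exact Module.nontrivial_of_finrank_pos (R := k) (by omega)

/-- For `U ⊆ Z₁ ≅ X₂` let `W` consist of the `x ∈ X₁` that all arrows send into `U`. By exactness
the kernel of `A_r ⊗ U ⟶ Z₂` has dimension at most `dim W`, and `dim W < dim U` since `X` is
expanding. So `U` generates more than `(r - 1) dim U ≥ dim U` dimensions. -/
theorem Expanding.of_shiftPair {X : Rep.{u, v} k r} {Z : Rep.{u, w} k r} (hX : X.Expanding)
    (p : ShiftPair X Z) (hr : 2 ≤ r) : Z.Expanding := by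
  intro U hU
  let W : Submodule k X.V₁ := ⨅ i, U.comap (p.e.toLinearMap ∘ₗ X.ψ (Pi.single i 1))
  have hUpos : 0 < Module.finrank k U :=
    Module.finrank_pos_iff.2 (Submodule.nontrivial_iff_ne_bot.2 hU)
  have hgen : X.generated W ≤ U.comap p.e.toLinearMap :=
    generated_le fun i m hm => (Submodule.mem_iInf _).1 hm i
  have hcomap : Module.finrank k (U.comap p.e.toLinearMap) = Module.finrank k U :=
    (p.e.ofSubmodule' U).finrank_eq
  have hW : Module.finrank k W < Module.finrank k U := by
    by_cases h : W = ⊥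
    · rw [h, finrank_bot]
      exact hUpos
    · exact (hX W h).trans_le ((Submodule.finrank_mono hgen).trans hcomap.le)
  let T := Z.total ∘ₗ U.subtype.compLeft (Fin r)
  have hker : Module.finrank k (LinearMap.ker T) ≤ Module.finrank k W := by
    have hinj : Function.Injective (U.subtype.compLeft (Fin r)) := fun x y h =>
      funext fun i => Subtype.ext (congrFun h i)
    refine (Submodule.equivMapOfInjective _ hinj (LinearMap.ker T)).finrank_eq.trans_le
      ((Submodule.finrank_mono ?_).trans <|
      Submodule.finrank_map_le (p.e.toLinearMap.compLeft (Fin r) ∘ₗ X.eta) W)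
    rintro _ ⟨y, hy, rfl⟩
    have hy' : Z.total (fun i => p.e (p.e.symm (y i).1)) = 0 := by
      simp only [LinearEquiv.apply_symm_apply]
      exact hy
    obtain ⟨x, hx⟩ := (p.exact _).1 hy'
    have hx' (i : Fin r) : p.e (X.ψ (Pi.single i 1) x) = (y i).1 := by
      rw [← eta_apply, hx, LinearEquiv.apply_symm_apply]
    refine ⟨x, (Submodule.mem_iInf _).2 fun i => ?_, funext hx'⟩
    rw [Submodule.mem_comap, LinearMap.comp_apply, LinearEquiv.coe_coe, hx']
    exact (y i).2
  have h := LinearMap.finrank_range_add_finrank_ker T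
  rw [Module.finrank_pi_fintype] at h
  simp only [Finset.sum_const, Finset.card_univ, Fintype.card_fin, smul_eq_mul] at h
  have h2 := Nat.mul_le_mul_right (Module.finrank k U) hr
  change _ < Module.finrank k (LinearMap.range T)
  omega

/-! ### Reducing the test conditions to `K_d` -/

theorem homEqZero_twist_left_iff (X : Rep.{u, v} k r) (M : Rep.{u, w} k r)
    (g : ArrowSpace k r ≃ₗ[k] ArrowSpace k r) :
    HomEqZero (X.twist g) M ↔ HomEqZero X (M.restrict g.toLinearMap) := by
  constructor
  · intro h f
    refine h ⟨f.f₁, f.f₂, fun a m => ?_⟩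
    refine (f.comm (g.symm a) m).trans ?_
    exact congrArg (fun b => M.ψ b (f.f₁ m)) (g.apply_symm_apply a)
  · intro h f
    refine h ⟨f.f₁, f.f₂, fun a m => ?_⟩
    refine Eq.trans ?_ (f.comm (g a) m)
    exact congrArg (fun b => f.f₂ (X.ψ b m)) (g.symm_apply_apply a).symm

theorem homEqZero_twist_right_iff (X : Rep.{u, v} k r) (M : Rep.{u, w} k r)
    (g : ArrowSpace k r ≃ₗ[k] ArrowSpace k r) :
    HomEqZero M (X.twist g) ↔ HomEqZero (M.restrict g.toLinearMap) X := by
  constructor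
  · intro h f
    refine h ⟨f.f₁, f.f₂, fun a m => ?_⟩
    refine Eq.trans ?_ (f.comm (g.symm a) m)
    exact congrArg (fun b => f.f₂ (M.ψ b m)) (g.apply_symm_apply a).symm
  · intro h f
    refine h ⟨f.f₁, f.f₂, fun a m => ?_⟩
    refine (f.comm (g a) m).trans ?_
    exact congrArg (fun b => X.ψ b (f.f₁ m)) (g.symm_apply_apply a)

end Rep

theorem incl_apply_castLE (h : d ≤ r) (a : ArrowSpace k d) (j : Fin d) :
    incl k h a (Fin.castLE h j) = a j :=
  (Fin.castLE_injective h).extend_apply a 0 j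

theorem incl_injective (h : d ≤ r) : Function.Injective (incl k h) := fun a b hab =>
  funext fun j => by rw [← incl_apply_castLE h a, hab, incl_apply_castLE]

theorem incl_single (h : d ≤ r) (j : Fin d) :
    incl k h (Pi.single j 1) = Pi.single (Fin.castLE h j) 1 := by
  ext i
  by_cases hi : ∃ l, Fin.castLE h l = i
  · obtain ⟨l, rfl⟩ := hi
    rw [incl_apply_castLE]
    simp [Pi.single_apply]
  · have h0 : incl k h (Pi.single j 1) i = 0 := Function.extend_apply' _ _ _ hi
    rw [h0, Pi.single_eq_of_ne]
    rintro rfl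
    exact hi ⟨j, rfl⟩

theorem funLeft_single_castLE (h : d ≤ r) (j : Fin d) :
    LinearMap.funLeft k k (Fin.castLE h) (Pi.single (Fin.castLE h j) 1) = Pi.single j 1 := by
  ext l
  simp [LinearMap.funLeft_apply, Pi.single_apply]

theorem funLeft_single_of_notMem (h : d ≤ r) {i : Fin r} (hi : i ∉ Set.range (Fin.castLE h)) :
    LinearMap.funLeft k k (Fin.castLE h) (Pi.single i 1) = 0 := by
  ext l
  rw [LinearMap.funLeft_apply, Pi.single_eq_of_ne]
  · rfl
  · rintro rfl
    exact hi ⟨l, rfl⟩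

namespace Rep

theorem shiftOrthogonal_inflate_left_iff (h : d ≤ r) (X : Rep.{u, v} k d) (M : Rep.{u, w} k r) :
    ShiftOrthogonal (X.inflate h) M ↔ ShiftOrthogonal X (M.restrict (incl k h)) := by
  refine forall_congr' fun f => imp_congr_left (forall_congr' fun x => Eq.congr_left ?_)
  have key (f : X.V₂ →ₗ[k] M.V₁) (x : X.V₁) :
      ∑ i, M.ψ (Pi.single i 1)
          (f (X.ψ (LinearMap.funLeft k k (Fin.castLE h) (Pi.single i 1)) x)) =
        ∑ j, M.ψ (incl k h (Pi.single j 1)) (f (X.ψ (Pi.single j 1) x)) := by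
    refine (Fintype.sum_of_injective (Fin.castLE h) (Fin.castLE_injective h) _ _ ?_ ?_).symm
    · intro i hi
      simp [funLeft_single_of_notMem h hi]
    · intro j
      rw [funLeft_single_castLE, incl_single]
  exact key f x

theorem shiftOrthogonal_inflate_right_iff (h : d ≤ r) (X : Rep.{u, v} k d)
    (M : Rep.{u, w} k r) :
    ShiftOrthogonal M (X.inflate h) ↔ ShiftOrthogonal (M.restrict (incl k h)) X := by
  refine forall_congr' fun f => imp_congr_left (forall_congr' fun x => Eq.congr_left ?_)
  have key (f : M.V₂ →ₗ[k] X.V₁) (x : M.V₁) :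
      ∑ i, X.ψ (LinearMap.funLeft k k (Fin.castLE h) (Pi.single i 1))
          (f (M.ψ (Pi.single i 1) x)) =
        ∑ j, X.ψ (Pi.single j 1) (f (M.ψ (incl k h (Pi.single j 1)) x)) := by
    refine (Fintype.sum_of_injective (Fin.castLE h) (Fin.castLE_injective h) _ _ ?_ ?_).symm
    · intro i hi
      simp [funLeft_single_of_notMem h hi]
    · intro j
      rw [funLeft_single_castLE, incl_single]
  exact key f x

end Rep

/-- Two injections of `A_d` with the same image differ by an automorphism of `A_d`; this makes the
choices of `α` and `g` immaterial. -/
theorem exists_restrict_eq (h : d ≤ r) (M : Rep.{u, v} k r)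
    (α : ArrowSpace k d →ₗ[k] ArrowSpace k r) (hα : Function.Injective α)
    (g : ArrowSpace k r ≃ₗ[k] ArrowSpace k r)
    (hg : LinearMap.range (g.toLinearMap ∘ₗ incl k h) = LinearMap.range α) :
    ∃ e : ArrowSpace k d ≃ₗ[k] ArrowSpace k d,
      (M.restrict g.toLinearMap).restrict (incl k h) =
        (M.restrict α).restrict e.toLinearMap := by
  have hgi : Function.Injective (g.toLinearMap ∘ₗ incl k h) :=
    g.injective.comp (incl_injective h)
  let e := ((LinearEquiv.ofInjective _ hgi).trans (LinearEquiv.ofEq _ _ hg)).trans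
    (LinearEquiv.ofInjective α hα).symm
  have he : g.toLinearMap ∘ₗ incl k h = α ∘ₗ e.toLinearMap := by
    refine LinearMap.ext fun a => ?_
    have : LinearEquiv.ofInjective α hα (e a) =
        LinearEquiv.ofEq _ _ hg (LinearEquiv.ofInjective _ hgi a) := by
      simp [e]
    exact (congrArg Subtype.val this).symm
  exact ⟨e, congrArg (fun L => M.restrict L) he⟩

theorem homEqZero_testMinus_iff (h : d ≤ r) {X : Rep.{u, v} k d} (hX : X.TwistInvariant)
    (M : Rep.{u, w} k r) (α : ArrowSpace k d →ₗ[k] ArrowSpace k r) (hα : Function.Injective α)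
    (g : ArrowSpace k r ≃ₗ[k] ArrowSpace k r)
    (hg : LinearMap.range (g.toLinearMap ∘ₗ incl k h) = LinearMap.range α) :
    Rep.HomEqZero (testMinus h g X) M ↔ Rep.ShiftOrthogonal X (M.restrict α) := by
  obtain ⟨e, he⟩ := exists_restrict_eq h M α hα g hg
  rw [testMinus, Rep.homEqZero_twist_left_iff, Rep.homEqZero_shiftInv_iff,
    Rep.shiftOrthogonal_inflate_left_iff, he, hX.shiftOrthogonal_left_iff]

theorem homEqZero_testPlus_iff (h : d ≤ r) {X : Rep.{u, v} k d} (hX : X.TwistInvariant)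
    (M : Rep.{u, w} k r) (α : ArrowSpace k d →ₗ[k] ArrowSpace k r) (hα : Function.Injective α)
    (g : ArrowSpace k r ≃ₗ[k] ArrowSpace k r)
    (hg : LinearMap.range (g.toLinearMap ∘ₗ incl k h) = LinearMap.range α) :
    Rep.HomEqZero M (testPlus h g X) ↔ Rep.ShiftOrthogonal (M.restrict α) X := by
  obtain ⟨e, he⟩ := exists_restrict_eq h M α hα g hg
  rw [testPlus, Rep.homEqZero_twist_right_iff, Rep.homEqZero_shift_iff,
    Rep.shiftOrthogonal_inflate_right_iff, he, hX.shiftOrthogonal_right_iff]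

namespace Rep

/-! ### Orthogonality and direct sums -/

/-- Transport of a pair along an isomorphism. -/
def ShiftPair.congrLeft {X : Rep.{u, v} k r} {X' : Rep.{u, v'} k r} {Z : Rep.{u, w} k r}
    (p : ShiftPair X' Z) (f : Iso X X') : ShiftPair X Z where
  e := f.e₂.trans p.e
  exact y := by
    refine (p.exact fun i => f.e₂ (y i)).trans ⟨?_, ?_⟩
    · rintro ⟨x, hx⟩
      refine ⟨f.e₁.symm x, funext fun i => f.e₂.injective ?_⟩
      rw [eta_apply, f.comm, f.e₁.apply_symm_apply]
      exact congrFun hx i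
    · rintro ⟨x, rfl⟩
      exact ⟨f.e₁ x, funext fun i => (f.comm _ _).symm⟩

/-- The zero representation. -/
def zero (k : Type u) [Field k] (r : ℕ) : Rep.{u, u} k r := ⟨PUnit, PUnit, 0⟩

/-- `M ⊕ 0 ≅ M`. -/
def sumZero (M : Rep.{u, v} k r) : Iso (M.sum (zero k r)) M where
  e₁ := (LinearEquiv.prodUnique : (M.V₁ × PUnit.{u + 1}) ≃ₗ[k] M.V₁)
  e₂ := (LinearEquiv.prodUnique : (M.V₂ × PUnit.{u + 1}) ≃ₗ[k] M.V₂)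
  comm _ _ := rfl

theorem ShiftOrthogonal.of_sum_right {X : Rep.{u, v} k r} {N : Rep.{u, w} k r}
    {N' : Rep.{u, w'} k r} (h : ShiftOrthogonal X (N.sum N')) : ShiftOrthogonal X N := by
  intro f hf
  have key (x : X.V₁) : ∑ i, ((N.ψ (Pi.single i 1) (f (X.ψ (Pi.single i 1) x)),
      N'.ψ (Pi.single i 1) 0) : N.V₂ × N'.V₂) = 0 := by
    refine Prod.ext (Prod.fst_sum.trans (hf x)) (Prod.snd_sum.trans ?_)
    simp
  have h₀ : LinearMap.inl k N.V₁ N'.V₁ ∘ₗ f = 0 := h _ key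
  exact LinearMap.ext fun x => congrArg Prod.fst (LinearMap.congr_fun h₀ x)

theorem ShiftOrthogonal.of_sum_left {X : Rep.{u, v} k r} {N : Rep.{u, w} k r}
    {N' : Rep.{u, w'} k r} (h : ShiftOrthogonal (N.sum N') X) : ShiftOrthogonal N X := by
  intro f hf
  have h₀ : f ∘ₗ LinearMap.fst k N.V₂ N'.V₂ = 0 := h _ fun x => hf x.1
  exact LinearMap.ext fun x => LinearMap.congr_fun h₀ (x, 0)

theorem ShiftOrthogonal.sum_right {X : Rep.{u, v} k r} {N : Rep.{u, w} k r}
    {N' : Rep.{u, w'} k r} (h : ShiftOrthogonal X N) (h' : ShiftOrthogonal X N') :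
    ShiftOrthogonal X (N.sum N') := by
  intro f hf
  have h₁ : LinearMap.fst k N.V₁ N'.V₁ ∘ₗ f = 0 := h _ fun x =>
    Prod.fst_sum.symm.trans (congrArg Prod.fst (hf x))
  have h₂ : LinearMap.snd k N.V₁ N'.V₁ ∘ₗ f = 0 := h' _ fun x =>
    Prod.snd_sum.symm.trans (congrArg Prod.snd (hf x))
  exact LinearMap.ext fun x => Prod.ext (LinearMap.congr_fun h₁ x) (LinearMap.congr_fun h₂ x)

theorem ShiftOrthogonal.sum_left {X : Rep.{u, v} k r} {N : Rep.{u, w} k r}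
    {N' : Rep.{u, w'} k r} (h : ShiftOrthogonal N X) (h' : ShiftOrthogonal N' X) :
    ShiftOrthogonal (N.sum N') X := by
  intro f hf
  have hz : ∀ a : ArrowSpace k r, (N.ψ a 0, N'.ψ a 0) = 0 := fun a => by simp
  have h₁ : f ∘ₗ LinearMap.inl k N.V₂ N'.V₂ = 0 := h _ fun x => by
    refine Eq.trans (Finset.sum_congr rfl fun i _ => ?_) (hf (x, 0))
    exact congrArg (fun z => X.ψ (Pi.single i 1) (f z)) (Prod.ext rfl (map_zero _).symm)
  have h₂ : f ∘ₗ LinearMap.inr k N.V₂ N'.V₂ = 0 := h' _ fun x => by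
    refine Eq.trans (Finset.sum_congr rfl fun i _ => ?_) (hf (0, x))
    exact congrArg (fun z => X.ψ (Pi.single i 1) (f z)) (Prod.ext (map_zero _).symm rfl)
  exact LinearMap.prod_ext h₁ h₂

theorem ShiftOrthogonal.copies_right {X : Rep.{u, v} k r} {N : Rep.{u, w} k r}
    (h : ShiftOrthogonal X N) (b : ℕ) : ShiftOrthogonal X (N.copies b) := by
  intro f hf
  have h₀ (j : Fin b) : LinearMap.proj j ∘ₗ (f : X.V₂ →ₗ[k] (Fin b → N.V₁)) = 0 :=
    h _ fun x => (Finset.sum_apply ..).symm.trans (congrFun (hf x) j)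
  exact LinearMap.ext fun x => funext fun j => LinearMap.congr_fun (h₀ j) x

theorem ShiftOrthogonal.copies_left {X : Rep.{u, v} k r} {N : Rep.{u, w} k r}
    (h : ShiftOrthogonal N X) (b : ℕ) : ShiftOrthogonal (N.copies b) X := by
  intro f hf
  have h₀ (j : Fin b) :
      (f : (Fin b → N.V₂) →ₗ[k] X.V₁) ∘ₗ LinearMap.single k (fun _ => N.V₂) j = 0 :=
    h _ fun x => by
      refine Eq.trans (Finset.sum_congr rfl fun i _ => ?_) (hf (Pi.single j x))
      refine congrArg (fun z => X.ψ (Pi.single i 1) (f z)) (funext fun l => ?_)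
      exact (Pi.apply_single (fun _ => N.ψ (Pi.single i 1)) (fun _ => map_zero _) j x l).symm
  exact LinearMap.pi_ext' h₀

theorem finrank_copies_sum₁ (X : Rep.{u, v} k r) (Y : Rep.{u, w} k r) (b c : ℕ) :
    Module.finrank k ((X.copies b).sum (Y.copies c)).V₁ =
      b * Module.finrank k X.V₁ + c * Module.finrank k Y.V₁ := by
  have : Module.finrank k ((Fin b → X.V₁) × (Fin c → Y.V₁)) =
      b * Module.finrank k X.V₁ + c * Module.finrank k Y.V₁ := by
    simp [Module.finrank_pi_fintype]
  exact this

theorem finrank_copies_sum₂ (X : Rep.{u, v} k r) (Y : Rep.{u, w} k r) (b c : ℕ) :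
    Module.finrank k ((X.copies b).sum (Y.copies c)).V₂ =
      b * Module.finrank k X.V₂ + c * Module.finrank k Y.V₂ := by
  have : Module.finrank k ((Fin b → X.V₂) × (Fin c → Y.V₂)) =
      b * Module.finrank k X.V₂ + c * Module.finrank k Y.V₂ := by
    simp [Module.finrank_pi_fintype]
  exact this

end Rep

open Kronecker.Rep

/-! ### The representations `P_n(d)` and their dimensions -/

section Preprojective

variable (k d)

theorem total_P1 (y : Fin d → k) : (P1 k d).total y = y := by
  have key : ∑ i, y i • (Pi.single i 1 : ArrowSpace k d) = y := by
    conv_rhs => rw [pi_eq_sum_univ' y]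
  exact (total_apply _ _).trans key

/-- `P_1 = σ⁻¹ P_0`. -/
def shiftPairP0P1 : ShiftPair (P0 k d) (P1 k d) where
  e := .refl k k
  exact y := by
    refine (Eq.congr_left (total_P1 k d y)).trans ⟨fun h => ⟨PUnit.unit, ?_⟩, ?_⟩
    · exact (map_zero (P0 k d).eta).trans h.symm
    · rintro ⟨x, rfl⟩
      exact map_zero (P0 k d).eta

theorem nonempty_shiftPair_P (n : ℕ) :
    Nonempty (ShiftPair (P k d n) (P k d (n + 1))) ∧
      Function.Surjective (P k d (n + 1)).total := by
  induction n with
  | zero => exact ⟨⟨shiftPairP0P1 k d⟩, fun y => ⟨y, total_P1 k d y⟩⟩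
  | succ n ih =>
    obtain ⟨⟨p⟩, hs⟩ := ih
    obtain ⟨f⟩ := ShiftPair.nonempty_iso p (P k d n).shiftPairShiftInv hs
      (shiftInv_total_surjective _) (.refl _)
    -- `P_{n+2}` is by definition `σ⁻¹ (σ⁻¹ P_n)`, and `f` identifies `P_{n+1}` with the inner `σ⁻¹
    -- P_n`.
    exact ⟨⟨(P k d n).shiftInv.shiftPairShiftInv.congrLeft f⟩, shiftInv_total_surjective _⟩

/-- `P_{n+1} = σ⁻¹ P_n`. -/
noncomputable def shiftPairP (n : ℕ) : ShiftPair (P k d n) (P k d (n + 1)) :=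
  (nonempty_shiftPair_P k d n).1.some

theorem total_P_succ_surjective (n : ℕ) : Function.Surjective (P k d (n + 1)).total :=
  (nonempty_shiftPair_P k d n).2

theorem twistInvariant_P (n : ℕ) : (P k d n).TwistInvariant := by
  induction n with
  | zero => exact fun e => ⟨⟨.refl k _, .refl k _, fun _ _ => rfl⟩⟩
  | succ n ih => exact ih.of_shiftPair (shiftPairP k d n) (total_P_succ_surjective k d n)

instance subsingleton_P_zero : Subsingleton (P k d 0).V₁ := inferInstanceAs (Subsingleton PUnit)

theorem expanding_P (hd : 2 ≤ d) (n : ℕ) : (P k d n).Expanding := by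
  induction n with
  | zero => exact fun U hU => (hU (Subsingleton.elim _ _)).elim
  | succ n ih => exact ih.of_shiftPair (shiftPairP k d n) hd

/-- For `d ≥ 2` this is expansion. For `d = 1` it fails at `n = 2`, where the representation is `(k,
0)`. -/
theorem eta_P_injective (hd : 1 ≤ d) (n : ℕ) (hn : d = 1 → n ≤ 1) :
    Function.Injective (P k d n).eta := by
  rcases hd.eq_or_lt with rfl | hd
  · obtain rfl | rfl : n = 0 ∨ n = 1 := by have := hn rfl; omega
    · exact Function.injective_of_subsingleton _
    · intro (x : k) (y : k) h
      have key (x : k) : (P k 1 1).eta x 0 = x • (Pi.single 0 1 : ArrowSpace k 1) := rfl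
      have h' : x • (Pi.single 0 1 : ArrowSpace k 1) = y • (Pi.single 0 1 : ArrowSpace k 1) :=
        (key x).symm.trans ((congrFun h 0).trans (key y))
      have h₀ := congrFun h' 0
      simp only [Pi.smul_apply, Pi.single_eq_same, smul_eq_mul, mul_one] at h₀
      exact h₀
  · exact (expanding_P k d hd n).eta_injective

theorem nontrivial_P₂ (hd : 1 ≤ d) (n : ℕ) (hn : d = 1 → n = 0) : Nontrivial (P k d n).V₂ := by
  rcases hd.eq_or_lt with rfl | hd
  · obtain rfl := hn rfl
    exact inferInstanceAs (Nontrivial k)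
  · clear hn
    induction n with
    | zero => exact inferInstanceAs (Nontrivial k)
    | succ n ih =>
      have := (shiftPairP k d n).e.symm.toEquiv.nontrivial
      exact (expanding_P k d hd (n + 1)).nontrivial

theorem finrank_P₂ (n : ℕ) : Module.finrank k (P k d n).V₂ = a k d (n + 1) :=
  (shiftPairP k d n).e.finrank_eq

theorem a_zero : a k d 0 = 0 := Module.finrank_zero_of_subsingleton

theorem a_one : a k d 1 = 1 := Module.finrank_self k

theorem a_add_two (hd : 1 ≤ d) (n : ℕ) (hn : d = 1 → n ≤ 1) :
    a k d (n + 2) + a k d n = d * a k d (n + 1) := by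
  have h := (shiftPairP k d n).finrank_add_finrank (eta_P_injective k d hd n hn)
    (total_P_succ_surjective k d n)
  rwa [finrank_P₂, finrank_P₂] at h

/-- A Cassini identity: the recursion `a_{n+2} + a_n = d a_{n+1}` preserves the left side. -/
theorem a_sq_sub (hd : 1 ≤ d) (n : ℕ) (hn : d = 1 → n ≤ 1) :
    (a k d (n + 1) : ℤ) ^ 2 - a k d n * a k d (n + 2) = 1 := by
  induction n with
  | zero => simp [a_zero, a_one]
  | succ n ih =>
    have h := ih fun h => by have := hn h; omega
    have h₁ : (a k d (n + 2) : ℤ) + a k d n = d * a k d (n + 1) := by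
      exact_mod_cast a_add_two k d hd n fun h => by have := hn h; omega
    have h₂ : (a k d (n + 3) : ℤ) + a k d (n + 1) = d * a k d (n + 2) := by
      exact_mod_cast a_add_two k d hd (n + 1) hn
    linear_combination h + (a k d (n + 2) : ℤ) * h₁ - (a k d (n + 1) : ℤ) * h₂

theorem homEqZero_P_succ_iff (n : ℕ) (N : Rep.{u, v} k d) :
    HomEqZero (P k d (n + 1)) N ↔ ShiftOrthogonal (P k d n) N :=
  (shiftPairP k d n).homEqZero_left_iff (total_P_succ_surjective k d n) N

theorem shiftOrthogonal_P_succ_iff (hd : 1 ≤ d) (n : ℕ) (hn : d = 1 → n ≤ 1)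
    (N : Rep.{u, v} k d) : ShiftOrthogonal N (P k d (n + 1)) ↔ HomEqZero N (P k d n) :=
  ((shiftPairP k d n).homEqZero_right_iff (eta_P_injective k d hd n hn) N).symm

theorem shiftOrthogonal_P_zero (N : Rep.{u, v} k d) : ShiftOrthogonal N (P k d 0) :=
  fun _ _ => LinearMap.ext fun _ => Subsingleton.elim _ _

/-- Moving one shift to each side turns `Hom(P_{n+2}, P_{n+1})` into `Hom(P_{n+1}, P_n)`. Only `η`
at the smaller index has to be injective, so `n = 2` is allowed when `d = 1`. -/
theorem homEqZero_P_succ_P (hd : 1 ≤ d) (n : ℕ) (hn : d = 1 → n ≤ 2) :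
    HomEqZero (P k d (n + 1)) (P k d n) := by
  induction n with
  | zero => exact (homEqZero_P_succ_iff ..).2 (shiftOrthogonal_P_zero k d _)
  | succ n ih =>
    rw [homEqZero_P_succ_iff,
      shiftOrthogonal_P_succ_iff k d hd n fun h => by have := hn h; omega]
    exact ih fun h => by have := hn h; omega

theorem shiftOrthogonal_P_succ_P (hd : 1 ≤ d) (n : ℕ) (hn : d = 1 → n ≤ 2) :
    ShiftOrthogonal (P k d (n + 1)) (P k d n) := by
  induction n with
  | zero => exact shiftOrthogonal_P_zero k d _
  | succ n ih =>
    rw [shiftOrthogonal_P_succ_iff k d hd n fun h => by have := hn h; omega,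
      homEqZero_P_succ_iff]
    exact ih fun h => by have := hn h; omega

theorem shiftOrthogonal_P_self (hd : 1 ≤ d) (n : ℕ) (hn : d = 1 → n ≤ 2) :
    ShiftOrthogonal (P k d n) (P k d n) :=
  (homEqZero_P_succ_iff ..).1 (homEqZero_P_succ_P k d hd n hn)

variable {k d}

/-! ### Characterizing `add(P_n, P_{n+1})` by orthogonality -/

theorem shiftOrthogonal_of_memAdd (hd : 1 ≤ d) (n : ℕ) (hn : d = 1 → n ≤ 1)
    {N : Rep.{u, v} k d} (h : N.MemAdd (P k d n) (P k d (n + 1))) :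
    ShiftOrthogonal (P k d (n + 1)) N ∧ ShiftOrthogonal N (P k d n) := by
  obtain ⟨N', b, c, ⟨f⟩⟩ := h
  have hn₂ : d = 1 → n ≤ 2 := fun h => (hn h).trans one_le_two
  have hn₃ : d = 1 → n + 1 ≤ 2 := fun h => Nat.succ_le_succ (hn h)
  have h₁ := shiftOrthogonal_P_succ_P k d hd n hn₂
  refine ⟨((h₁.copies_right b).sum_right
    ((shiftOrthogonal_P_self k d hd (n + 1) hn₃).copies_right c)).congr (.refl _) f.symm
      |>.of_sum_right, ?_⟩
  exact (((shiftOrthogonal_P_self k d hd n hn₂).copies_left b).sum_left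
    (h₁.copies_left c)).congr f.symm (.refl _) |>.of_sum_left

/-- A tuple `y` in the kernel of `ψ_N` gives the map `γ_i ↦ y_i` from `A_d` to `N₁`, which satisfies
the defining equation and so vanishes. -/
theorem total_injective_of_shiftOrthogonal {N : Rep.{u, v} k d}
    (h : ShiftOrthogonal (P k d 1) N) : Function.Injective N.total := by
  rw [injective_iff_map_eq_zero]
  intro y hy
  let f : ArrowSpace k d →ₗ[k] N.V₁ := Fintype.linearCombination k y
  have key (t : k) :
      ∑ i, N.ψ (Pi.single i 1) (f (t • (Pi.single i 1 : ArrowSpace k d))) = 0 := by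
    simp only [map_smul, f, Fintype.linearCombination_apply_single, one_smul]
    rw [← Finset.smul_sum, ← total_apply, hy, smul_zero]
  have hf : f = 0 := h f key
  ext i
  have := LinearMap.congr_fun hf (Pi.single i 1)
  simpa [f, Fintype.linearCombination_apply_single] using this

/-- A complement of the image of `ψ_N` splits off as copies of `P_0`; the image is `A_d ⊗ N₁`, which
together with `N₁` gives `dim N₁` copies of `P_1`. -/
theorem nonempty_iso_of_total_injective {N : Rep.{u, v} k d} (h : Function.Injective N.total) :
    ∃ b c : ℕ, Nonempty (Iso N (((P k d 0).copies b).sum ((P k d 1).copies c))) := by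
  obtain ⟨C, hC⟩ := (LinearMap.range N.total).exists_isCompl
  let b := Module.finrank k C
  let c := Module.finrank k N.V₁
  let eC : C ≃ₗ[k] (Fin b → k) := (Module.finBasis k C).equivFun
  let eN : N.V₁ ≃ₗ[k] (Fin c → k) := (Module.finBasis k N.V₁).equivFun
  let sw : (Fin d → Fin c → k) ≃ₗ[k] (Fin c → Fin d → k) :=
    { Equiv.piComm fun _ _ => k with
      map_add' := fun _ _ => rfl
      map_smul' := fun _ _ => rfl }
  let e₁ : N.V₁ ≃ₗ[k] (Fin b → PUnit.{u + 1}) × (Fin c → k) :=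
    eN.trans (LinearEquiv.prodUnique (R := k) (M := Fin c → k)
      (M₂ := Fin b → PUnit.{u + 1})).symm |>.trans (LinearEquiv.prodComm k _ _)
  let eR : LinearMap.range N.total ≃ₗ[k] (Fin c → Fin d → k) :=
    ((LinearEquiv.ofInjective N.total h).symm.trans (.piCongrRight fun _ => eN)).trans sw
  let e₂ : N.V₂ ≃ₗ[k] (Fin b → k) × (Fin c → Fin d → k) :=
    (Submodule.prodEquivOfIsCompl C _ hC.symm).symm.trans (eC.prodCongr eR)
  have key (a : ArrowSpace k d) (m : N.V₁) : e₂ (N.ψ a m) = (0, fun j => eN m j • a) := by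
    rw [← N.total_smul]
    have h₁ : (Submodule.prodEquivOfIsCompl C _ hC.symm).symm (N.total fun i => a i • m) =
        (0, LinearEquiv.ofInjective N.total h fun i => a i • m) := by
      rw [LinearEquiv.symm_apply_eq]
      simp
    simp only [e₂, LinearEquiv.trans_apply, h₁, LinearEquiv.prodCongr_apply, map_zero, eR,
      LinearEquiv.symm_apply_apply]
    refine Prod.ext rfl (funext fun j => funext fun i => ?_)
    have : eN (a i • m) j = eN m j * a i := by simp [mul_comm]
    exact this
  exact ⟨b, c, ⟨⟨e₁, e₂, key⟩⟩⟩

/-- Otherwise a nonzero functional on `N₂` killing the image of `ψ_N`, multiplied by a nonzero `x ∈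
X₂`, is a nonzero morphism `N ⟶ X`. -/
theorem total_surjective_of_homEqZero {N : Rep.{u, v} k d} {X : Rep.{u, w} k d}
    [Nontrivial X.V₂] (h : HomEqZero N X) : Function.Surjective N.total := by
  rw [← LinearMap.range_eq_top]
  by_contra hne
  obtain ⟨φ, hφ, hle⟩ := Submodule.exists_le_ker_of_lt_top _ (lt_top_iff_ne_top.2 hne)
  obtain ⟨x, hx⟩ := exists_ne (0 : X.V₂)
  have h₂ : φ.smulRight x = 0 := (h ⟨0, φ.smulRight x, fun a m => by
    have : φ (N.ψ a m) = 0 := hle ⟨fun i => a i • m, N.total_smul a m⟩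
    simp [this]⟩).2
  refine hφ (LinearMap.ext fun y => ?_)
  have := LinearMap.congr_fun h₂ y
  simpa [hx] using this

theorem nonempty_iso_of_shiftOrthogonal (hd : 1 ≤ d) (n : ℕ) (hn : d = 1 → n ≤ 1)
    (N : Rep.{u, v} k d) (h₁ : ShiftOrthogonal (P k d (n + 1)) N)
    (h₂ : ShiftOrthogonal N (P k d n)) :
    ∃ b c : ℕ, Nonempty (Iso N (((P k d n).copies b).sum ((P k d (n + 1)).copies c))) := by
  induction n generalizing N with
  | zero => exact nonempty_iso_of_total_injective (total_injective_of_shiftOrthogonal h₁)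
  | succ n ih =>
    have hn₀ : d = 1 → n = 0 := fun h => by have := hn h; omega
    have hn₁ : d = 1 → n ≤ 1 := fun h => (hn₀ h).trans_le zero_le_one
    have := nontrivial_P₂ k d hd n hn₀
    rw [shiftOrthogonal_P_succ_iff k d hd n hn₁] at h₂
    have hN := total_surjective_of_homEqZero h₂
    -- The first condition becomes `Hom(P_{n+2}, σ N) = 0`, with `P_{n+2} = σ⁻¹ P_{n+1}`; the second
    -- is `Hom(σ⁻¹ (σ N), P_n) = 0`.
    obtain ⟨b, c, ⟨f⟩⟩ := ih hn₁ N.shift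
      ((homEqZero_P_succ_iff ..).1 ((homEqZero_shift_iff _ _).2 h₁))
      ((N.shiftPairShift.homEqZero_left_iff hN _).1 h₂)
    exact ⟨b, c, N.shiftPairShift.nonempty_iso
      (((shiftPairP k d n).copies b).sum ((shiftPairP k d (n + 1)).copies c)) hN
      (ShiftPair.total_sum_surjective
        (ShiftPair.total_copies_surjective (total_P_succ_surjective k d n) b)
        (ShiftPair.total_copies_surjective (total_P_succ_surjective k d (n + 1)) c)) f⟩

end Preprojective

end Kronecker

/-- `α` is any injective map with image `𝔳`, so `α^*(M)` is any representative of `M|_𝔳`;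
`g₁, g₂` are any automorphisms with `g_i(A_d) = 𝔳`, so `testMinus _ g₁ (P k d (n + 1))` and
`testPlus _ g₂ (P k d n)` are any representatives of `P_{n+1}⁻(𝔳)` and `P_n⁺(𝔳)`. -/
theorem theorem4p3p5 {k : Type u} [Field k] [IsAlgClosed k] {d r : ℕ} (hd : 1 ≤ d) (hdr : d < r)
    (M : Kronecker.Rep.{u, v} k r) (n : ℕ) (hn : d = 1 → n ≤ 1)
    (𝔳 : Submodule k (Kronecker.ArrowSpace k r)) (h𝔳 : Module.finrank k 𝔳 = d)
    (α : Kronecker.ArrowSpace k d →ₗ[k] Kronecker.ArrowSpace k r)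
    (hα : Function.Injective α) (hα𝔳 : LinearMap.range α = 𝔳)
    (g₁ g₂ : Kronecker.ArrowSpace k r ≃ₗ[k] Kronecker.ArrowSpace k r)
    (hg₁ : LinearMap.range (g₁.toLinearMap ∘ₗ Kronecker.incl k hdr.le) = 𝔳)
    (hg₂ : LinearMap.range (g₂.toLinearMap ∘ₗ Kronecker.incl k hdr.le) = 𝔳) :
    List.TFAE [
      ∃ b c : ℕ,
        (b : ℤ) = - (Kronecker.a k d (n + 2) : ℤ) * (Module.finrank k M.V₁ : ℤ)
          + (Kronecker.a k d (n + 1) : ℤ) * (Module.finrank k M.V₂ : ℤ) ∧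
        (c : ℤ) = (Kronecker.a k d (n + 1) : ℤ) * (Module.finrank k M.V₁ : ℤ)
          - (Kronecker.a k d n : ℤ) * (Module.finrank k M.V₂ : ℤ) ∧
        Nonempty (Kronecker.Rep.Iso (M.restrict α)
          (((Kronecker.P k d n).copies b).sum ((Kronecker.P k d (n + 1)).copies c))),
      (M.restrict α).MemAdd (Kronecker.P k d n) (Kronecker.P k d (n + 1)),
      Kronecker.Rep.HomEqZero
          (Kronecker.testMinus hdr.le g₁ (Kronecker.P k d (n + 1))) M ∧
        Kronecker.Rep.HomEqZero M (Kronecker.testPlus hdr.le g₂ (Kronecker.P k d n))] := by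
  have hg₁' := hg₁.trans hα𝔳.symm
  have hg₂' := hg₂.trans hα𝔳.symm
  tfae_have 1 → 2 := by
    rintro ⟨b, c, -, -, ⟨f⟩⟩
    exact ⟨.zero k d, b, c, ⟨(Kronecker.Rep.sumZero _).trans f⟩⟩
  tfae_have 2 → 3 := by
    intro h
    rw [Kronecker.homEqZero_testMinus_iff _ (Kronecker.twistInvariant_P k d _) M α hα g₁ hg₁',
      Kronecker.homEqZero_testPlus_iff _ (Kronecker.twistInvariant_P k d _) M α hα g₂ hg₂']
    exact Kronecker.shiftOrthogonal_of_memAdd hd n hn h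
  tfae_have 3 → 1 := by
    rw [Kronecker.homEqZero_testMinus_iff _ (Kronecker.twistInvariant_P k d _) M α hα g₁ hg₁',
      Kronecker.homEqZero_testPlus_iff _ (Kronecker.twistInvariant_P k d _) M α hα g₂ hg₂']
    rintro ⟨h₁, h₂⟩
    obtain ⟨b, c, ⟨f⟩⟩ := Kronecker.nonempty_iso_of_shiftOrthogonal hd n hn _ h₁ h₂
    have hf₁ := f.e₁.finrank_eq
    have hf₂ := f.e₂.finrank_eq
    rw [Kronecker.Rep.finrank_copies_sum₁] at hf₁
    rw [Kronecker.Rep.finrank_copies_sum₂, Kronecker.finrank_P₂, Kronecker.finrank_P₂] at hf₂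
    have hm₁ : (Module.finrank k M.V₁ : ℤ) =
        b * Kronecker.a k d n + c * Kronecker.a k d (n + 1) := by exact_mod_cast hf₁
    have hm₂ : (Module.finrank k M.V₂ : ℤ) =
        b * Kronecker.a k d (n + 1) + c * Kronecker.a k d (n + 2) := by exact_mod_cast hf₂
    -- The determinant that inverts the system `hm₁`, `hm₂` for `b` and `c`; as `b` and `c` are
    -- multiplicities, the integers in statement 1 are non-negative.
    have ha := Kronecker.a_sq_sub k d hd n hn
    refine ⟨b, c, ?_, ?_, ⟨f⟩⟩
    · rw [hm₁, hm₂]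
      linear_combination -(b : ℤ) * ha
    · rw [hm₁, hm₂]
      linear_combination -(c : ℤ) * ha
  tfae_finish
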